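/- Let $\mathfrak H$ and $\mathfrak H_n$ ($n\in\mathbb N$) be separable complex Hilbert spaces with $\mathfrak H_n\neq\{0\}$, let $J_n:\mathfrak H\to\mathfrak H_n$ be bounded linear operators, and let $A$ and $A_n$ be (possibly unbounded) self-adjoint operators in $\mathfrak H$ and $\mathfrak H_n$, respectively. Write $\rho(\cdot)$ and $\sigma(\cdot)$ for the resolvent set and the spectrum, $R_T(z)=(T-z)^{-1}$ for $z\in\rho(T)$, and $\Gamma=\mathbb C\setminus\overline{\sigma(A)\cup\bigcup_n\sigma(A_n)}$. For sets $S_n\subseteq\mathbb C$ let $\lim_{n\to\infty}S_n$ be the set of all $\lambda\in\mathbb C$ for which there is a sequence $\lambda_n\in S_n$ converging to $\lambda$. We say that $A_n$ converges to $A$ in generalized norm resolvent sense if $\sup_n\|J_n\|<\infty$, $\|J_n^*J_n-\mathbb I\|\to0$, $\|J_nJ_n^*-\mathbb I\|\to0$, and $\|J_n^*R_{A_n}(z)J_n-R_A(z)\|\to0$ for one $z\in\Gamma$. We say that $A_n$ converges to $A$ in generalized strong resolvent sense if $\sup_n\|J_n\|<\infty$, $\|J_n^*J_n\psi-\psi\|\to0$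 for all $\psi\in\mathfrak H$, and there is one $z\in\Gamma$ such that $\|J_n^*R_{A_n}(z)J_n\psi-R_A(z)\psi\|\to0$ for all $\psi\in\mathfrak H$ and, in case $z$ is real, also $\|R_{A_n}(z)J_n\psi-J_nR_A(z)\psi\|\to0$ for all $\psi\in\mathfrak H$. (i) If $A_n$ converges to $A$ in generalized strong resolvent sense, then $\sigma(A)\subseteq\lim_{n\to\infty}\sigma(A_n)$. (ii) If $A_n$ converges to $A$ in generalized norm resolvent sense, then $\sigma(A)=\lim_{n\to\infty}\sigma(A_n)$. Moreover, every $\lambda\in\rho(A)$ has a neighbourhood $U\subseteq\mathbb C$ such that $U\subseteq\rho(A_n)$ for all sufficiently large $n$. -/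

import Mathlib

open Filter Topology

noncomputable section

namespace GenRes

section Resolvent

variable {H : Type*} [NormedAddCommGroup H] [InnerProductSpace ℂ H]

/-- `R` is a bounded, everywhere defined two-sided inverse of `A - z : D(A) → H`. -/
def IsResolventAt (A : H →ₗ.[ℂ] H) (z : ℂ) (R : H →L[ℂ] H) : Prop :=
  (∀ x : H, ∃ h : R x ∈ A.domain, A ⟨R x, h⟩ - z • R x = x) ∧
    ∀ x : A.domain, R (A x - z • (x : H)) = x

theorem IsResolventAt.unique {A : H →ₗ.[ℂ] H} {z : ℂ} {R S : H →L[ℂ] H}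
    (hR : IsResolventAt A z R) (hS : IsResolventAt A z S) : R = S := by
  ext x
  obtain ⟨h, hx⟩ := hS.1 x
  have h1 := hR.2 ⟨S x, h⟩
  rw [hx] at h1
  exact h1

/-- The resolvent set `ρ(A)` of an unbounded operator. -/
def resolventSet (A : H →ₗ.[ℂ] H) : Set ℂ :=
  {z | ∃ R : H →L[ℂ] H, IsResolventAt A z R}

/-- The spectrum `σ(A) = ℂ \ ρ(A)` of an unbounded operator. -/
def spectrum (A : H →ₗ.[ℂ] H) : Set ℂ :=
  (resolventSet A)ᶜ

open scoped Classical in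
/-- The resolvent `R_A(z) = (A - z)⁻¹` for `z ∈ ρ(A)` (and `0` for the other `z`). -/
def resolvent (A : H →ₗ.[ℂ] H) (z : ℂ) : H →L[ℂ] H :=
  if h : ∃ R : H →L[ℂ] H, IsResolventAt A z R then h.choose else 0

theorem resolvent_spec {A : H →ₗ.[ℂ] H} {z : ℂ} (hz : z ∈ resolventSet A) :
    IsResolventAt A z (resolvent A z) := by
  have h : ∃ R : H →L[ℂ] H, IsResolventAt A z R := hz
  rw [resolvent, dif_pos h]
  exact h.choose_spec

end Resolvent

/-- `lim S n`: the set of all limits of convergent sequences `l` with `l n ∈ S n`. -/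
def limSet (S : ℕ → Set ℂ) : Set ℂ :=
  {a | ∃ l : ℕ → ℂ, (∀ n, l n ∈ S n) ∧ Tendsto l atTop (𝓝 a)}

section Convergence

variable {H : Type*} [NormedAddCommGroup H] [InnerProductSpace ℂ H] [CompleteSpace H]
  {K : ℕ → Type*} [∀ n, NormedAddCommGroup (K n)] [∀ n, InnerProductSpace ℂ (K n)]
  [∀ n, CompleteSpace (K n)]

/-- `Γ`: the complement of the closure of `σ(A) ∪ ⋃ n, σ(A n)`. -/
def commonResolventSet (A : H →ₗ.[ℂ] H) (An : ∀ n, K n →ₗ.[ℂ] K n) : Set ℂ :=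
  (closure (spectrum A ∪ ⋃ n, spectrum (An n)))ᶜ

/-- The condition on the `J n` for norm convergence. Once both norms are below `1`, each `J n` is
bijective and the two norms agree. -/
def EmbeddingNorm (J : ∀ n, H →L[ℂ] K n) : Prop :=
  (∃ C : ℝ, 0 < C ∧ ∀ n, ‖J n‖ ≤ C) ∧
    Tendsto (fun n => ‖(J n).adjoint ∘L J n - ContinuousLinearMap.id ℂ H‖) atTop (𝓝 0) ∧
    Tendsto (fun n => ‖J n ∘L (J n).adjoint - ContinuousLinearMap.id ℂ (K n)‖) atTop (𝓝 0)

/-- The condition on the `J n` for strong convergence. -/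
def EmbeddingStrong (J : ∀ n, H →L[ℂ] K n) : Prop :=
  (∃ C : ℝ, 0 < C ∧ ∀ n, ‖J n‖ ≤ C) ∧
    ∀ ψ : H, Tendsto (fun n => ‖(J n).adjoint (J n ψ) - ψ‖) atTop (𝓝 0)

/-- `An n` converges to `A` in generalized norm resolvent sense. -/
def NormResolventConv (J : ∀ n, H →L[ℂ] K n) (An : ∀ n, K n →ₗ.[ℂ] K n) (A : H →ₗ.[ℂ] H) :
    Prop :=
  EmbeddingNorm J ∧ ∃ z ∈ commonResolventSet A An,
    Tendsto (fun n => ‖(J n).adjoint ∘L resolvent (An n) z ∘L J n - resolvent A z‖) atTop (𝓝 0)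

/-- `An n` converges to `A` in generalized strong resolvent sense (for self-adjoint operators).
Only at a real point `z` is the unsandwiched limit relation required as well; there the
sandwiched one alone does not control the operators. -/
def StrongResolventConv (J : ∀ n, H →L[ℂ] K n) (An : ∀ n, K n →ₗ.[ℂ] K n) (A : H →ₗ.[ℂ] H) :
    Prop :=
  EmbeddingStrong J ∧ ∃ z ∈ commonResolventSet A An,
    (∀ ψ : H, Tendsto (fun n => ‖(J n).adjoint (resolvent (An n) z (J n ψ)) - resolvent A z ψ‖)
      atTop (𝓝 0)) ∧
    (z.im = 0 → ∀ ψ : H, Tendsto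
      (fun n => ‖resolvent (An n) z (J n ψ) - J n (resolvent A z ψ)‖) atTop (𝓝 0))

end Convergence

end GenRes

end

/-! For self-adjoint `T`, `z ∈ ρ(T)` holds exactly when `c‖x‖ ≤ ‖(T - z)x‖` for some `c > 0`, and
then the ball of radius `c` about `z` lies in `ρ(T)`. Both inclusions come from moving such bounds
between `A` and `A_n`. Lower semicontinuity: for `λ ∈ σ(A)` choose `x` with `(A - λ)x` small. Then
`u_n = R_{A_n}(z) J_n (A - z)x` is close to `J_n x`, so it is an approximate eigenvector of `A_n`,
and `σ(A_n)` comes near `λ` by `le_norm_sub_smul_of_ball_subset`. This uses `R_{A_n}(z)J_n - J_n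
R_A(z) → 0` strongly, which for non-real `z` follows from the identity for `Im ⟨R x, x⟩`. Upper
semicontinuity: for `λ ∈ ρ(A)`, `NormResolventConv.exists_eventually_le` carries the bound for `A -
λ` over to `A_n - λ` with a constant free of `n`, so a fixed ball about `λ` eventually avoids
`σ(A_n)`. -/

namespace GenRes

/-! ### Resolvents and lower bounds for a single operator. -/

section SelfAdjoint

variable {H : Type*} [NormedAddCommGroup H] [InnerProductSpace ℂ H]

theorem IsResolventAt.mem_domain {T : H →ₗ.[ℂ] H} {z : ℂ} {R : H →L[ℂ] H}
    (hR : IsResolventAt T z R) (x : H) : R x ∈ T.domain :=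
  (hR.1 x).1

theorem IsResolventAt.map_apply {T : H →ₗ.[ℂ] H} {z : ℂ} {R : H →L[ℂ] H}
    (hR : IsResolventAt T z R) (x : H) : T ⟨R x, hR.mem_domain x⟩ = x + z • R x :=
  sub_eq_iff_eq_add.1 (hR.1 x).2

theorem IsResolventAt.sub_eq {T : H →ₗ.[ℂ] H} {z w : ℂ} {R S : H →L[ℂ] H}
    (hR : IsResolventAt T z R) (hS : IsResolventAt T w S) (x : H) :
    S x - R x = (w - z) • S (R x) := by
  have h := hS.2 ⟨R x, hR.mem_domain x⟩
  rw [hR.map_apply] at h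
  simp only [map_sub, map_add, map_smul] at h
  rw [sub_smul, ← sub_eq_zero, ← sub_eq_zero.2 h]
  abel

theorem le_norm_sub_smul_of_isResolventAt {T : H →ₗ.[ℂ] H} {z : ℂ} {R : H →L[ℂ] H}
    (hR : IsResolventAt T z R) {c : ℝ} (hc : c * ‖R‖ ≤ 1) (x : T.domain) (hc0 : 0 ≤ c) :
    c * ‖(x : H)‖ ≤ ‖T x - z • (x : H)‖ := by
  have h := R.le_opNorm (T x - z • (x : H))
  rw [hR.2 x] at h
  calc c * ‖(x : H)‖ ≤ c * (‖R‖ * ‖T x - z • (x : H)‖) := by gcongr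
    _ = (c * ‖R‖) * ‖T x - z • (x : H)‖ := by ring
    _ ≤ 1 * ‖T x - z • (x : H)‖ := by gcongr
    _ = _ := one_mul _

/-- An operator is bounded below at every point of its resolvent set. -/
theorem exists_le_norm_sub_smul {T : H →ₗ.[ℂ] H} {z : ℂ} (hz : z ∈ resolventSet T) :
    ∃ c : ℝ, 0 < c ∧ ∀ x : T.domain, c * ‖(x : H)‖ ≤ ‖T x - z • (x : H)‖ := by
  obtain ⟨R, hR⟩ := hz
  have h0 : 0 < ‖R‖ + 1 := by positivity
  refine ⟨(‖R‖ + 1)⁻¹, by positivity, fun x =>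
    le_norm_sub_smul_of_isResolventAt hR ?_ x (by positivity)⟩
  rw [inv_mul_le_iff₀ h0]
  linarith

theorem IsResolventAt.norm_le {T : H →ₗ.[ℂ] H} {z : ℂ} {R : H →L[ℂ] H}
    (hR : IsResolventAt T z R) {c : ℝ} (hc : 0 < c)
    (h : ∀ x : T.domain, c * ‖(x : H)‖ ≤ ‖T x - z • (x : H)‖) : ‖R‖ ≤ c⁻¹ := by
  refine R.opNorm_le_bound (by positivity) fun x => ?_
  have := h ⟨R x, hR.mem_domain x⟩
  rw [hR.map_apply, add_sub_cancel_right] at this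
  rwa [inv_mul_eq_div, le_div_iff₀' hc]

/-- By the resolvent identity, the inverse of `μ - R` is `μ⁻¹(1 + μ⁻¹ S)`. This ties the spectrum of
the bounded operator `R` to that of `T`. -/
theorem isUnit_sub_of_isResolventAt {T : H →ₗ.[ℂ] H} {z μ : ℂ} {R S : H →L[ℂ] H} (hμ : μ ≠ 0)
    (hR : IsResolventAt T z R) (hS : IsResolventAt T (z + μ⁻¹) S) :
    IsUnit (algebraMap ℂ (H →L[ℂ] H) μ - R) := by
  have h1 : ∀ x, μ • S x - μ • R x = S (R x) := fun x => by
    rw [← smul_sub, hR.sub_eq hS, add_sub_cancel_left, smul_inv_smul₀ hμ]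
  have h2 : ∀ x, μ • S x - μ • R x = R (S x) := fun x => by
    rw [← smul_sub, ← neg_sub, hS.sub_eq hR, sub_add_cancel_left, neg_smul, neg_neg,
      smul_inv_smul₀ hμ]
  refine isUnit_iff_exists.2 ⟨μ⁻¹ • (1 + μ⁻¹ • S), ?_, ?_⟩
  · ext x
    simp [Algebra.algebraMap_eq_smul_one, ← h2, smul_sub, smul_smul, hμ]
  · ext x
    simp [Algebra.algebraMap_eq_smul_one, ← h1, smul_sub, smul_smul, hμ]

variable [CompleteSpace H]

theorem inner_map_eq {T : H →ₗ.[ℂ] H} (hT : IsSelfAdjoint T) (x y : T.domain) :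
    inner ℂ (T x) (y : H) = inner ℂ (x : H) (T y) := by
  have h := LinearPMap.adjoint_isFormalAdjoint hT.dense_domain
  rw [LinearPMap.isSelfAdjoint_def.1 hT] at h
  exact h x y

theorem mem_domain_of_inner {T : H →ₗ.[ℂ] H} (hT : IsSelfAdjoint T) (y w : H)
    (h : ∀ x : T.domain, inner ℂ w (x : H) = inner ℂ y (T x)) :
    ∃ hy : y ∈ T.domain, T ⟨y, hy⟩ = w := by
  have h1 := LinearPMap.mem_adjoint_domain_of_exists y ⟨w, h⟩
  have h2 := LinearPMap.adjoint_apply_eq hT.dense_domain ⟨y, h1⟩ h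
  -- The domain proof depends on the operator, so `T.adjoint = T` is substituted through a variable
  -- `S`, not rewritten.
  have key : ∀ S : H →ₗ.[ℂ] H, S = T → ∀ h1 : y ∈ S.domain, S ⟨y, h1⟩ = w →
      ∃ hy : y ∈ T.domain, T ⟨y, hy⟩ = w := by
    rintro S rfl h1 h2
    exact ⟨h1, h2⟩
  exact key _ (LinearPMap.isSelfAdjoint_def.1 hT) h1 h2

theorem im_inner_map_self {T : H →ₗ.[ℂ] H} (hT : IsSelfAdjoint T) (x : T.domain) :
    (inner ℂ (x : H) (T x)).im = 0 := by
  rw [← Complex.conj_eq_iff_im, inner_conj_symm, inner_map_eq hT]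

theorem im_inner_sub_smul {T : H →ₗ.[ℂ] H} (hT : IsSelfAdjoint T) (z : ℂ) (x : T.domain) :
    (inner ℂ (x : H) (T x - z • (x : H))).im = -z.im * ‖(x : H)‖ ^ 2 := by
  rw [inner_sub_right, inner_smul_right, inner_self_eq_norm_sq_to_K, Complex.sub_im,
    im_inner_map_self hT, Complex.mul_im]
  simp [← Complex.ofReal_pow]

/-- Needed because the orthogonal complement of the range of `T - z` is the kernel of `T - conj z`.
-/
theorem norm_sub_conj_smul {T : H →ₗ.[ℂ] H} (hT : IsSelfAdjoint T) (z : ℂ) (x : T.domain) :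
    ‖T x - (starRingEnd ℂ) z • (x : H)‖ = ‖T x - z • (x : H)‖ := by
  have him := im_inner_map_self hT x
  have him' : (inner ℂ (T x) (x : H)).im = 0 := by rw [inner_map_eq hT, him]
  rw [← sq_eq_sq₀ (norm_nonneg _) (norm_nonneg _), @norm_sub_sq ℂ, @norm_sub_sq ℂ]
  simp [inner_smul_right, norm_smul, him']

theorem abs_im_mul_norm_le {T : H →ₗ.[ℂ] H} (hT : IsSelfAdjoint T) (z : ℂ) (x : T.domain) :
    |z.im| * ‖(x : H)‖ ≤ ‖T x - z • (x : H)‖ := by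
  rcases eq_or_ne (x : H) 0 with hx | hx
  · simp [hx]
  have h := im_inner_sub_smul hT z x
  have h1 := (Complex.abs_im_le_norm _).trans (norm_inner_le_norm (𝕜 := ℂ) (x : H) (T x - z • (x : H)))
  rw [h, abs_mul, abs_neg, abs_of_nonneg (sq_nonneg ‖(x : H)‖)] at h1
  have hx' : 0 < ‖(x : H)‖ := norm_pos_iff.2 hx
  refine le_of_mul_le_mul_left ?_ hx'
  linarith

theorem IsResolventAt.im_inner {T : H →ₗ.[ℂ] H} (hT : IsSelfAdjoint T) {z : ℂ} {R : H →L[ℂ] H}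
    (hR : IsResolventAt T z R) (x : H) : (inner ℂ (R x) x).im = -z.im * ‖R x‖ ^ 2 := by
  have h := im_inner_sub_smul hT z ⟨R x, hR.mem_domain x⟩
  rwa [hR.map_apply, add_sub_cancel_right] at h

/-- A point at which a self-adjoint operator is bounded below lies in the resolvent set. -/
theorem mem_resolventSet_of_le {T : H →ₗ.[ℂ] H} (hT : IsSelfAdjoint T) {z : ℂ} {c : ℝ}
    (hc : 0 < c) (h : ∀ x : T.domain, c * ‖(x : H)‖ ≤ ‖T x - z • (x : H)‖) :
    z ∈ resolventSet T := by
  let F : T.domain →ₗ[ℂ] H := T.toFun - z • T.domain.subtype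
  have hF : ∀ x, F x = T x - z • (x : H) := fun x => rfl
  have hinj : ∀ x, F x = 0 → x = 0 := by
    intro x hx
    have := h x
    rw [← hF, hx, norm_zero] at this
    have h0 : ‖(x : H)‖ = 0 := le_antisymm (by nlinarith [norm_nonneg (x : H)]) (norm_nonneg _)
    exact Subtype.ext (norm_eq_zero.1 h0)
  -- The lower bound makes preimages of a convergent sequence Cauchy, and a self-adjoint operator is
  -- closed.
  have hclosed : IsClosed (LinearMap.range F : Set H) := by
    refine IsSeqClosed.isClosed fun u y hu huy => ?_
    choose x hx using hu
    have hux : ∀ m n, c * ‖(x m : H) - x n‖ ≤ ‖u m - u n‖ := by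
      intro m n
      have := h (x m - x n)
      rwa [← hF, map_sub, hx, hx, Submodule.coe_sub] at this
    have hcau : CauchySeq fun n => (x n : H) := by
      rw [Metric.cauchySeq_iff']
      intro ε hε
      obtain ⟨N, hN⟩ := Metric.cauchySeq_iff'.1 huy.cauchySeq (c * ε) (by positivity)
      refine ⟨N, fun n hn => ?_⟩
      have h1 := hN n hn
      rw [dist_eq_norm] at h1 ⊢
      exact lt_of_mul_lt_mul_left ((hux n N).trans_lt h1) hc.le
    obtain ⟨a, ha⟩ := cauchySeq_tendsto_of_complete hcau
    have hTx : Tendsto (fun n => T (x n)) atTop (𝓝 (y + z • a)) := by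
      have : (fun n => T (x n)) = fun n => u n + z • (x n : H) := by
        funext n
        rw [← hx n, hF, sub_add_cancel]
      rw [this]
      exact huy.add (ha.const_smul z)
    obtain ⟨haT, hay⟩ := mem_domain_of_inner hT a (y + z • a) fun v => by
      refine tendsto_nhds_unique (hTx.inner tendsto_const_nhds) ?_
      simp_rw [inner_map_eq hT]
      exact ha.inner tendsto_const_nhds
    exact ⟨⟨a, haT⟩, by rw [hF, hay, add_sub_cancel_right]⟩
  have hsurj : LinearMap.range F = ⊤ := by
    have : CompleteSpace (LinearMap.range F) := hclosed.completeSpace_coe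
    rw [← Submodule.orthogonal_eq_bot_iff, Submodule.eq_bot_iff]
    intro y hy
    rw [Submodule.mem_orthogonal'] at hy
    obtain ⟨hyT, hyz⟩ := mem_domain_of_inner hT y ((starRingEnd ℂ) z • y) fun v => by
      have := hy _ ⟨v, rfl⟩
      rw [hF, inner_sub_right, inner_smul_right, sub_eq_zero] at this
      rw [inner_smul_left, this, Complex.conj_conj]
    have h1 := h ⟨y, hyT⟩
    rw [← norm_sub_conj_smul hT, hyz] at h1
    simp only [sub_self, norm_zero] at h1
    have h0 : ‖y‖ = 0 := le_antisymm (by nlinarith [norm_nonneg y]) (norm_nonneg _)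
    exact norm_eq_zero.1 h0
  let e : T.domain ≃ₗ[ℂ] H := LinearEquiv.ofBijective F
    ⟨(injective_iff_map_eq_zero F).2 hinj, LinearMap.range_eq_top.1 hsurj⟩
  have he : ∀ x, e x = T x - z • (x : H) := fun x => rfl
  refine ⟨(T.domain.subtype ∘ₗ e.symm.toLinearMap).mkContinuous c⁻¹ fun y => ?_,
    fun y => ⟨(e.symm y).2, ?_⟩, fun x => ?_⟩
  · have h1 := h (e.symm y)
    rw [← he, e.apply_symm_apply] at h1
    rw [inv_mul_eq_div, le_div_iff₀' hc]
    exact h1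
  · exact (he (e.symm y)).symm.trans (e.apply_symm_apply y)
  · change ((e.symm (e x) : T.domain) : H) = x
    rw [e.symm_apply_apply]

theorem mem_resolventSet_of_im_ne_zero {T : H →ₗ.[ℂ] H} (hT : IsSelfAdjoint T) {z : ℂ}
    (hz : z.im ≠ 0) : z ∈ resolventSet T :=
  mem_resolventSet_of_le hT (abs_pos.2 hz) (abs_im_mul_norm_le hT z)

theorem ball_subset_resolventSet {T : H →ₗ.[ℂ] H} (hT : IsSelfAdjoint T) {z : ℂ} {c : ℝ}
    (h : ∀ x : T.domain, c * ‖(x : H)‖ ≤ ‖T x - z • (x : H)‖) :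
    Metric.ball z c ⊆ resolventSet T := by
  intro w hw
  rw [mem_ball_iff_norm] at hw
  refine mem_resolventSet_of_le hT (sub_pos.2 hw) fun x => ?_
  have h1 : T x - z • (x : H) = (T x - w • (x : H)) + (w - z) • (x : H) := by
    rw [sub_smul]; abel
  have h2 := norm_add_le (T x - w • (x : H)) ((w - z) • (x : H))
  rw [← h1, norm_smul] at h2
  linarith [h x]

theorem IsResolventAt.isSelfAdjoint {T : H →ₗ.[ℂ] H} (hT : IsSelfAdjoint T) {z : ℂ}
    (hz : z.im = 0) {R : H →L[ℂ] H} (hR : IsResolventAt T z R) : IsSelfAdjoint R := by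
  rw [ContinuousLinearMap.isSelfAdjoint_iff_isSymmetric]
  intro x y
  have h := inner_map_eq hT ⟨R x, hR.mem_domain x⟩ ⟨R y, hR.mem_domain y⟩
  rw [hR.map_apply, hR.map_apply, inner_add_left, inner_add_right, inner_smul_left,
    inner_smul_right, Complex.conj_eq_iff_im.2 hz] at h
  exact (add_right_cancel h).symm

/-- The resolvent estimate `‖R_T(z)‖ ≤ 1 / dist(z, σ(T))` at real points, as a lower bound. -/
theorem le_norm_sub_smul_of_ball_subset {T : H →ₗ.[ℂ] H} (hT : IsSelfAdjoint T) {z : ℂ}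
    (hz : z.im = 0) {ε : ℝ} (hε : 0 < ε) (h : Metric.ball z ε ⊆ resolventSet T) (x : T.domain) :
    ε * ‖(x : H)‖ ≤ ‖T x - z • (x : H)‖ := by
  rcases subsingleton_or_nontrivial H with hH | hH
  · simp [Subsingleton.elim (x : H) 0]
  obtain ⟨R, hR⟩ := h (Metric.mem_ball_self hε)
  refine le_norm_sub_smul_of_isResolventAt hR ?_ x hε.le
  -- `R` is self-adjoint, so its norm is attained as `|μ|` on its spectrum. If `|μ| > 1/ε`, then `z
  -- + μ⁻¹` would lie in the ball.
  obtain ⟨μ, hμ, hμR⟩ := _root_.spectrum.exists_nnnorm_eq_spectralRadius R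
  rw [(hR.isSelfAdjoint hT hz).spectralRadius_eq_nnnorm, ENNReal.coe_inj] at hμR
  have hn : ‖μ‖ = ‖R‖ := congrArg NNReal.toReal hμR
  rw [← hn]
  by_contra! hlt
  have hμ0 : μ ≠ 0 := by
    rintro rfl
    simp at hlt
    linarith
  obtain ⟨S, hS⟩ : z + μ⁻¹ ∈ resolventSet T := by
    apply h
    rw [mem_ball_iff_norm, add_sub_cancel_left, norm_inv]
    exact inv_lt_of_inv_lt₀ hε (by rwa [inv_lt_iff_one_lt_mul₀' hε])
  exact hμ (isUnit_sub_of_isResolventAt hμ0 hR hS)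

/-- With empty spectrum the distance estimate would hold for every `ε`, forcing the dense domain to
be zero. Nonemptiness matters because `limSet` asks for a point of every `S n`. -/
theorem spectrum_nonempty [Nontrivial H] {T : H →ₗ.[ℂ] H} (hT : IsSelfAdjoint T) :
    (spectrum T).Nonempty := by
  by_contra hne
  have hρ : ∀ z, z ∈ resolventSet T := fun z => by
    by_contra hz
    exact hne ⟨z, hz⟩
  have h0 : ∀ x : T.domain, (x : H) = 0 := by
    intro x
    by_contra hx
    have hx' : 0 < ‖(x : H)‖ := norm_pos_iff.2 hx
    have := le_norm_sub_smul_of_ball_subset hT (z := 0) rfl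
      (ε := (‖T x‖ + 1) / ‖(x : H)‖) (by positivity) (fun z _ => hρ z) x
    rw [div_mul_cancel₀ _ hx'.ne', zero_smul, sub_zero] at this
    linarith
  obtain ⟨y, hy⟩ := exists_ne (0 : H)
  refine hy (hT.dense_domain.eq_zero_of_inner_left ℂ fun v hv => ?_)
  rw [show v = 0 from h0 ⟨v, hv⟩, inner_zero_right]

/-- Weyl's criterion, in the direction giving approximate eigenvectors. -/
theorem exists_norm_sub_smul_lt {T : H →ₗ.[ℂ] H} (hT : IsSelfAdjoint T) {z : ℂ}
    (hz : z ∈ spectrum T) {δ : ℝ} (hδ : 0 < δ) :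
    ∃ x : T.domain, ‖T x - z • (x : H)‖ < δ * ‖(x : H)‖ := by
  by_contra! h
  exact hz (mem_resolventSet_of_le hT hδ h)

theorem im_eq_zero_of_mem_spectrum {T : H →ₗ.[ℂ] H} (hT : IsSelfAdjoint T) {z : ℂ}
    (hz : z ∈ spectrum T) : z.im = 0 := by
  by_contra h
  exact hz (mem_resolventSet_of_im_ne_zero hT h)

/-- A lower bound for `T - z` that depends only on `z` and its distance to the spectrum. -/
theorem exists_uniform_le_norm_sub_smul (z : ℂ) {ε : ℝ} (hε : 0 < ε) :
    ∃ c : ℝ, 0 < c ∧ ∀ (G : Type*) [NormedAddCommGroup G] [InnerProductSpace ℂ G]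
      [CompleteSpace G] (T : G →ₗ.[ℂ] G), IsSelfAdjoint T → Metric.ball z ε ⊆ resolventSet T →
      ∀ x : T.domain, c * ‖(x : G)‖ ≤ ‖T x - z • (x : G)‖ := by
  by_cases hz : z.im = 0
  · exact ⟨ε, hε, fun G _ _ _ T hT h => le_norm_sub_smul_of_ball_subset hT hz hε h⟩
  · exact ⟨|z.im|, abs_pos.2 hz, fun G _ _ _ T hT _ => abs_im_mul_norm_le hT z⟩

end SelfAdjoint

end GenRes

namespace GenRes

/-! ### Limits of spectra under strong resolvent convergence. -/

section Convergence

variable {H : Type*} [NormedAddCommGroup H] [InnerProductSpace ℂ H]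
  {K : ℕ → Type*} [∀ n, NormedAddCommGroup (K n)] [∀ n, InnerProductSpace ℂ (K n)]

theorem exists_ball_subset_of_mem_commonResolventSet {A : H →ₗ.[ℂ] H} {An : ∀ n, K n →ₗ.[ℂ] K n}
    {z : ℂ} (hz : z ∈ commonResolventSet A An) :
    ∃ ε : ℝ, 0 < ε ∧ Metric.ball z ε ⊆ resolventSet A ∧
      ∀ n, Metric.ball z ε ⊆ resolventSet (An n) := by
  obtain ⟨ε, hε, h⟩ := Metric.isOpen_iff.1 (isClosed_closure.isOpen_compl) z hz
  refine ⟨ε, hε, fun w hw => ?_, fun n w hw => ?_⟩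
  · by_contra hc
    exact h hw (subset_closure (Or.inl hc))
  · by_contra hc
    exact h hw (subset_closure (Or.inr (Set.mem_iUnion.2 ⟨n, hc⟩)))

theorem mem_limSet_of_eventually_dist_lt {S : ℕ → Set ℂ} (hS : ∀ n, (S n).Nonempty) {a : ℂ}
    (h : ∀ ε > 0, ∀ᶠ n in atTop, ∃ b ∈ S n, dist a b < ε) : a ∈ limSet S := by
  have h1 : ∀ n : ℕ, ∃ b ∈ S n, dist a b < Metric.infDist a (S n) + 1 / ((n : ℝ) + 1) := fun n =>
    (Metric.infDist_lt_iff (hS n)).1 (lt_add_of_pos_right _ (by positivity))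
  choose l hl hd using h1
  refine ⟨l, hl, ?_⟩
  have h2 : Tendsto (fun n => Metric.infDist a (S n)) atTop (𝓝 0) := by
    rw [Metric.tendsto_atTop']
    intro ε hε
    obtain ⟨N, hN⟩ := eventually_atTop.1 (h ε hε)
    refine ⟨N, fun n hn => ?_⟩
    rw [Real.dist_0_eq_abs, abs_of_nonneg Metric.infDist_nonneg]
    exact (Metric.infDist_lt_iff (hS n)).2 (hN n hn.le)
  have h3 := h2.add (tendsto_one_div_add_atTop_nhds_zero_nat (𝕜 := ℝ))
  rw [add_zero] at h3
  rw [tendsto_iff_dist_tendsto_zero]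
  exact squeeze_zero (fun _ => dist_nonneg) (fun n => by rw [dist_comm]; exact (hd n).le) h3

variable [CompleteSpace H] [∀ n, CompleteSpace (K n)]

theorem EmbeddingStrong.tendsto_adjoint_apply {J : ∀ n, H →L[ℂ] K n} (hJ : EmbeddingStrong J)
    (ψ : H) : Tendsto (fun n => (J n).adjoint (J n ψ)) atTop (𝓝 ψ) :=
  tendsto_iff_norm_sub_tendsto_zero.2 (hJ.2 ψ)

theorem EmbeddingStrong.tendsto_norm_sq {J : ∀ n, H →L[ℂ] K n} (hJ : EmbeddingStrong J) (ψ : H) :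
    Tendsto (fun n => ‖J n ψ‖ ^ 2) atTop (𝓝 (‖ψ‖ ^ 2)) := by
  have h := (Complex.continuous_re.tendsto _).comp
    ((hJ.tendsto_adjoint_apply ψ).inner (𝕜 := ℂ) (tendsto_const_nhds (x := ψ)))
  have h1 : (inner ℂ ψ ψ).re = ‖ψ‖ ^ 2 := inner_self_eq_norm_sq (𝕜 := ℂ) ψ
  rw [h1] at h
  refine h.congr fun n => ?_
  simp only [Function.comp_apply, ContinuousLinearMap.adjoint_inner_left]
  exact inner_self_eq_norm_sq (𝕜 := ℂ) (J n ψ)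

theorem EmbeddingStrong.tendsto_norm {J : ∀ n, H →L[ℂ] K n} (hJ : EmbeddingStrong J) (ψ : H) :
    Tendsto (fun n => ‖J n ψ‖) atTop (𝓝 ‖ψ‖) := by
  simpa [Real.sqrt_sq] using (hJ.tendsto_norm_sq ψ).sqrt

/-- At a non-real point, the sandwiched strong limit relation implies the unsandwiched one. -/
theorem tendsto_resolvent_sub_of_im_ne_zero {J : ∀ n, H →L[ℂ] K n} {An : ∀ n, K n →ₗ.[ℂ] K n}
    {A : H →ₗ.[ℂ] H} (hAn : ∀ n, IsSelfAdjoint (An n)) (hA : IsSelfAdjoint A)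
    (hJ : EmbeddingStrong J) {z : ℂ} (hz : z.im ≠ 0) (ψ : H)
    (h : Tendsto (fun n => ‖(J n).adjoint (resolvent (An n) z (J n ψ)) - resolvent A z ψ‖)
      atTop (𝓝 0)) :
    Tendsto (fun n => ‖resolvent (An n) z (J n ψ) - J n (resolvent A z ψ)‖) atTop (𝓝 0) := by
  have hR := resolvent_spec (mem_resolventSet_of_im_ne_zero hA hz)
  have hRn := fun n => resolvent_spec (mem_resolventSet_of_im_ne_zero (hAn n) hz)
  have hu := tendsto_iff_norm_sub_tendsto_zero.2 h
  set v := resolvent A z ψ with hv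
  -- `Im ⟨R x, x⟩ = -Im z ‖R x‖²` turns convergence of inner products into convergence of norms.
  have hsq : Tendsto (fun n => ‖resolvent (An n) z (J n ψ)‖ ^ 2) atTop (𝓝 (‖v‖ ^ 2)) := by
    have h1 := ((Complex.continuous_im.tendsto _).comp
      (hu.inner (𝕜 := ℂ) (tendsto_const_nhds (x := ψ)))).div_const (-z.im)
    rw [hv, hR.im_inner hA, mul_div_cancel_left₀ _ (neg_ne_zero.2 hz)] at h1
    refine h1.congr fun n => ?_
    rw [Function.comp_apply, ContinuousLinearMap.adjoint_inner_left, (hRn n).im_inner (hAn n),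
      mul_div_cancel_left₀ _ (neg_ne_zero.2 hz)]
  have hre := (Complex.continuous_re.tendsto _).comp
    (hu.inner (𝕜 := ℂ) (tendsto_const_nhds (x := v)))
  rw [show (inner ℂ v v).re = ‖v‖ ^ 2 from inner_self_eq_norm_sq (𝕜 := ℂ) v] at hre
  have hlim := ((hsq.sub (hre.const_mul 2)).add (hJ.tendsto_norm_sq v)).sqrt
  rw [show ‖v‖ ^ 2 - 2 * ‖v‖ ^ 2 + ‖v‖ ^ 2 = 0 by ring, Real.sqrt_zero] at hlim
  refine hlim.congr fun n => ?_
  rw [Function.comp_apply, ContinuousLinearMap.adjoint_inner_left]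
  rw [← Real.sqrt_sq (norm_nonneg (resolvent (An n) z (J n ψ) - J n v)), @norm_sub_sq ℂ]
  rfl

/-- The unsandwiched strong limit relation at a common point of the resolvent sets makes the
spectrum lower semicontinuous. -/
theorem spectrum_subset_limSet_of_tendsto [∀ n, Nontrivial (K n)] {J : ∀ n, H →L[ℂ] K n}
    {An : ∀ n, K n →ₗ.[ℂ] K n} {A : H →ₗ.[ℂ] H} (hAn : ∀ n, IsSelfAdjoint (An n))
    (hA : IsSelfAdjoint A) (hJ : EmbeddingStrong J) {z : ℂ} (hzA : z ∈ resolventSet A)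
    (hzn : ∀ n, z ∈ resolventSet (An n))
    (h : ∀ ψ : H, Tendsto (fun n => ‖resolvent (An n) z (J n ψ) - J n (resolvent A z ψ)‖)
      atTop (𝓝 0)) :
    spectrum A ⊆ limSet fun n => spectrum (An n) := by
  intro l hl
  refine mem_limSet_of_eventually_dist_lt (fun n => spectrum_nonempty (hAn n)) fun ε hε => ?_
  obtain ⟨x, hx⟩ := exists_norm_sub_smul_lt hA hl hε
  set φ := A x - z • (x : H)
  have hxφ : resolvent A z φ = x := (resolvent_spec hzA).2 x
  have hdiff := h φ
  rw [hxφ] at hdiff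
  have hl1 : Tendsto (fun n => ‖z - l‖ * ‖resolvent (An n) z (J n φ) - J n x‖
      + ‖J n (A x - l • (x : H))‖) atTop (𝓝 (‖z - l‖ * 0 + ‖A x - l • (x : H)‖)) :=
    (hdiff.const_mul _).add (hJ.tendsto_norm _)
  have hl2 : Tendsto (fun n => ε * (‖J n x‖ - ‖resolvent (An n) z (J n φ) - J n x‖)) atTop
      (𝓝 (ε * (‖(x : H)‖ - 0))) :=
    ((hJ.tendsto_norm _).sub hdiff).const_mul _
  filter_upwards [hl1.eventually_lt hl2 (by simpa using hx)] with n hn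
  by_contra! hfar
  have hR := resolvent_spec (hzn n)
  set u := resolvent (An n) z (J n φ)
  have hlow := le_norm_sub_smul_of_ball_subset (hAn n) (im_eq_zero_of_mem_spectrum hA hl) hε
    (fun w hw => by
      by_contra hc
      rw [Metric.mem_ball, dist_comm] at hw
      exact absurd hw (not_lt.2 (hfar w hc))) ⟨u, hR.mem_domain _⟩
  rw [hR.map_apply] at hlow
  -- The left side is `(A_n - l)u`; both terms on the right are controlled in the limit.
  have heq : J n φ + z • u - l • u = (z - l) • (u - J n x) + J n (A x - l • (x : H)) := by
    simp only [φ, map_sub, map_smul, smul_sub, sub_smul]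
    abel
  change ε * ‖u‖ ≤ ‖J n φ + z • u - l • u‖ at hlow
  rw [heq] at hlow
  have h1 := norm_add_le ((z - l) • (u - J n x)) (J n (A x - l • (x : H)))
  rw [norm_smul] at h1
  have h2 : ‖J n x‖ - ‖u - J n x‖ ≤ ‖u‖ := by
    have := norm_sub_norm_le (J n x) (J n x - u)
    rw [sub_sub_cancel, norm_sub_rev (J n x) u] at this
    exact this
  have h3 := mul_le_mul_of_nonneg_left h2 hε.le
  linarith

theorem spectrum_subset_limSet_of_strongResolventConv [∀ n, Nontrivial (K n)]
    {J : ∀ n, H →L[ℂ] K n} {An : ∀ n, K n →ₗ.[ℂ] K n} {A : H →ₗ.[ℂ] H}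
    (hAn : ∀ n, IsSelfAdjoint (An n)) (hA : IsSelfAdjoint A) (h : StrongResolventConv J An A) :
    spectrum A ⊆ limSet fun n => spectrum (An n) := by
  obtain ⟨hJ, z, hz, h1, h2⟩ := h
  obtain ⟨ε, hε, hzA, hzn⟩ := exists_ball_subset_of_mem_commonResolventSet hz
  refine spectrum_subset_limSet_of_tendsto hAn hA hJ (hzA (Metric.mem_ball_self hε))
    (fun n => hzn n (Metric.mem_ball_self hε)) ?_
  by_cases him : z.im = 0
  · exact h2 him
  · exact fun ψ => tendsto_resolvent_sub_of_im_ne_zero hAn hA hJ him ψ (h1 ψ)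

/-! ### Norm resolvent convergence. -/

theorem EmbeddingNorm.embeddingStrong {J : ∀ n, H →L[ℂ] K n} (hJ : EmbeddingNorm J) :
    EmbeddingStrong J := by
  refine ⟨hJ.1, fun ψ => ?_⟩
  have h := hJ.2.1.mul_const ‖ψ‖
  rw [zero_mul] at h
  exact squeeze_zero (fun _ => norm_nonneg _) (fun n => ContinuousLinearMap.le_opNorm
    ((J n).adjoint ∘L J n - ContinuousLinearMap.id ℂ H) ψ) h

/-- The resolvents at a point of `Γ` are uniformly bounded. -/
theorem exists_norm_resolvent_le {An : ∀ n, K n →ₗ.[ℂ] K n} (hAn : ∀ n, IsSelfAdjoint (An n))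
    {z : ℂ} {ε : ℝ} (hε : 0 < ε) (h : ∀ n, Metric.ball z ε ⊆ resolventSet (An n)) :
    ∃ B : ℝ, 0 < B ∧ ∀ n, ‖resolvent (An n) z‖ ≤ B := by
  obtain ⟨c, hc, hlow⟩ := exists_uniform_le_norm_sub_smul z hε
  exact ⟨c⁻¹, by positivity, fun n => (resolvent_spec (h n (Metric.mem_ball_self hε))).norm_le hc
    (hlow (K n) (An n) (hAn n) (h n))⟩

/-- Generalized norm resolvent convergence implies generalized strong resolvent convergence. -/
theorem NormResolventConv.strongResolventConv {J : ∀ n, H →L[ℂ] K n} {An : ∀ n, K n →ₗ.[ℂ] K n}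
    {A : H →ₗ.[ℂ] H} (hAn : ∀ n, IsSelfAdjoint (An n)) (h : NormResolventConv J An A) :
    StrongResolventConv J An A := by
  obtain ⟨hJ, z, hz, hlim⟩ := h
  obtain ⟨ε, hε, -, hzn⟩ := exists_ball_subset_of_mem_commonResolventSet hz
  obtain ⟨B, hB, hRB⟩ := exists_norm_resolvent_le hAn hε hzn
  have hJs := hJ.embeddingStrong
  obtain ⟨⟨C, hC, hJC⟩, -, hJJ⟩ := hJ
  have hsand : ∀ n ψ, ‖(J n).adjoint (resolvent (An n) z (J n ψ)) - resolvent A z ψ‖ ≤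
      ‖(J n).adjoint ∘L resolvent (An n) z ∘L J n - resolvent A z‖ * ‖ψ‖ := fun n ψ =>
    ContinuousLinearMap.le_opNorm
      ((J n).adjoint ∘L resolvent (An n) z ∘L J n - resolvent A z) ψ
  refine ⟨hJs, z, hz, fun ψ => ?_, fun _ ψ => ?_⟩
  · have h0 := hlim.mul_const ‖ψ‖
    rw [zero_mul] at h0
    exact squeeze_zero (fun _ => norm_nonneg _) (fun n => hsand n ψ) h0
  · have h0 := ((hlim.mul_const ‖ψ‖).const_mul C).add (hJJ.mul_const (B * (C * ‖ψ‖)))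
    simp only [zero_mul, mul_zero, add_zero] at h0
    refine squeeze_zero (fun _ => norm_nonneg _) (fun n => ?_) h0
    set u := resolvent (An n) z (J n ψ) with hu
    -- The sandwiched difference is undone by `J_n`, at the cost of the small error `J_n J_n^* - 1`.
    have h1 : u - J n (resolvent A z ψ) = J n ((J n).adjoint u - resolvent A z ψ)
        - (J n ∘L (J n).adjoint - ContinuousLinearMap.id ℂ (K n)) u := by
      simp
    have h2 : ‖u‖ ≤ B * (C * ‖ψ‖) :=
      (resolvent (An n) z).le_of_opNorm_le_of_le (hRB n) ((J n).le_of_opNorm_le (hJC n) ψ)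
    rw [h1]
    exact (norm_sub_le _ _).trans (add_le_add
      ((J n).le_of_opNorm_le_of_le (hJC n) (hsand n ψ))
      (ContinuousLinearMap.le_opNorm_of_le _ h2))

/-- Under generalized norm resolvent convergence, lower bounds for `A - l` pass to `An n - l`. -/
theorem NormResolventConv.exists_eventually_le {J : ∀ n, H →L[ℂ] K n}
    {An : ∀ n, K n →ₗ.[ℂ] K n} {A : H →ₗ.[ℂ] H} (hAn : ∀ n, IsSelfAdjoint (An n))
    (h : NormResolventConv J An A) {l : ℂ} (hl : l ∈ resolventSet A) :
    ∃ c : ℝ, 0 < c ∧ ∀ᶠ n in atTop, ∀ u : (An n).domain,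
      c * ‖(u : K n)‖ ≤ ‖An n u - l • (u : K n)‖ := by
  obtain ⟨⟨⟨C, hC, hJC⟩, -, hJJ⟩, z, hz, hlim⟩ := h
  obtain ⟨ε, hε, hzA, hzn⟩ := exists_ball_subset_of_mem_commonResolventSet hz
  obtain ⟨B, hB, hRB⟩ := exists_norm_resolvent_le hAn hε hzn
  obtain ⟨c, hc, hlow⟩ := exists_le_norm_sub_smul hl
  have hR := resolvent_spec (hzA (Metric.mem_ball_self hε))
  have hRn := fun n => resolvent_spec (hzn n (Metric.mem_ball_self hε))
  have hJC' : ∀ n, ‖(J n).adjoint‖ ≤ C := fun n => by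
    rw [LinearIsometryEquiv.norm_map]
    exact hJC n
  set d := ‖z - l‖ with hd
  set F : ℕ → ℝ := fun n => ‖J n ∘L (J n).adjoint - ContinuousLinearMap.id ℂ (K n)‖ with hF
  set D : ℕ → ℝ := fun n => ‖(J n).adjoint ∘L resolvent (An n) z ∘L J n - resolvent A z‖ with hD
  have hκ : Tendsto (fun n => C * (d + c) * (D n * C + C * (B * F n))) atTop (𝓝 0) := by
    have := ((hlim.mul_const C).add ((hJJ.const_mul B).const_mul C)).const_mul (C * (d + c))
    simpa only [zero_mul, mul_zero, add_zero] using this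
  have hκd := hκ.mul_const d
  rw [zero_mul] at hκd
  -- Combining `h7` and `h8` leaves `(c/4)‖u‖ ≤ (C² + 1)‖g‖`.
  refine ⟨c / 4 / (C ^ 2 + 1), by positivity, ?_⟩
  filter_upwards [hκ.eventually_lt_const one_pos,
    hκd.eventually_lt_const (show 0 < c / 4 by positivity),
    hJJ.eventually_lt_const (show (0 : ℝ) < 1 / 2 by norm_num)] with n hn1 hn2 hn3 u
  set f := An n u - z • (u : K n) with hf
  have hu : resolvent (An n) z f = u := (hRn n).2 u
  -- `ψ` replaces `J_n^* u`, which need not lie in the domain of `A`; `η‖f‖` bounds the error.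
  set ψ := resolvent A z ((J n).adjoint f) with hψ
  set η := D n * C + C * (B * F n) with hη
  have h1 : ‖(J n).adjoint (u : K n) - ψ‖ ≤ η * ‖f‖ := by
    have e : (J n).adjoint (u : K n) - ψ =
        ((J n).adjoint ∘L resolvent (An n) z ∘L J n - resolvent A z) ((J n).adjoint f)
        - (J n).adjoint (resolvent (An n) z
          ((J n ∘L (J n).adjoint - ContinuousLinearMap.id ℂ (K n)) f)) := by
      simp [hu, hψ]
    rw [e, hη, add_mul, mul_assoc, mul_assoc, mul_assoc]
    exact (norm_sub_le _ _).trans (add_le_add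
      (ContinuousLinearMap.le_opNorm_of_le _ ((J n).adjoint.le_of_opNorm_le (hJC' n) f))
      ((J n).adjoint.le_of_opNorm_le_of_le (hJC' n)
        ((resolvent (An n) z).le_of_opNorm_le_of_le (hRB n) (ContinuousLinearMap.le_opNorm _ f))))
  set g := An n u - l • (u : K n) with hg
  have hgf : g = f + (z - l) • (u : K n) := by
    rw [hg, hf, sub_smul]
    abel
  have h2 : c * ‖ψ‖ ≤ C * ‖g‖ + d * (η * ‖f‖) := by
    have h3 := hlow ⟨ψ, hR.mem_domain _⟩
    rw [hR.map_apply] at h3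
    change c * ‖ψ‖ ≤ ‖(J n).adjoint f + z • ψ - l • ψ‖ at h3
    have e : (J n).adjoint f + z • ψ - l • ψ =
        (J n).adjoint g - (z - l) • ((J n).adjoint (u : K n) - ψ) := by
      rw [hgf, map_add, map_smul, smul_sub, sub_smul z l ψ]
      abel
    rw [e] at h3
    refine h3.trans ((norm_sub_le _ _).trans
      (add_le_add ((J n).adjoint.le_of_opNorm_le (hJC' n) g) ?_))
    rw [norm_smul]
    gcongr
  have h4 : ‖(J n).adjoint (u : K n)‖ ≤ ‖ψ‖ + η * ‖f‖ := by
    have := norm_sub_norm_le ((J n).adjoint (u : K n)) ψ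
    linarith
  have h5 : ‖(u : K n)‖ ≤ C * ‖(J n).adjoint (u : K n)‖ + 1 / 2 * ‖(u : K n)‖ := by
    have e : (u : K n) = J n ((J n).adjoint (u : K n))
        - (J n ∘L (J n).adjoint - ContinuousLinearMap.id ℂ (K n)) u := by simp
    calc ‖(u : K n)‖ = ‖J n ((J n).adjoint (u : K n))
          - (J n ∘L (J n).adjoint - ContinuousLinearMap.id ℂ (K n)) u‖ := by rw [← e]
      _ ≤ _ := (norm_sub_le _ _).trans (add_le_add ((J n).le_of_opNorm_le (hJC n) _)
          (ContinuousLinearMap.le_of_opNorm_le _ hn3.le _))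
  have h6 : ‖f‖ ≤ ‖g‖ + d * ‖(u : K n)‖ := by
    have e : f = g - (z - l) • (u : K n) := by rw [hgf, add_sub_cancel_right]
    have := norm_sub_le g ((z - l) • (u : K n))
    rwa [← e, norm_smul] at this
  have hη0 : 0 ≤ η := by positivity
  have h7 : c * ‖(u : K n)‖ / 2 ≤ C ^ 2 * ‖g‖ + C * (d + c) * η * ‖f‖ := by
    have a1 := mul_le_mul_of_nonneg_left h4 hc.le
    have a2 : c * ‖(J n).adjoint (u : K n)‖ ≤ C * ‖g‖ + (d + c) * (η * ‖f‖) := by linarith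
    have a3 := mul_le_mul_of_nonneg_left a2 hC.le
    have a4 := mul_le_mul_of_nonneg_left h5 hc.le
    linarith
  -- As `‖f‖ ≤ ‖g‖ + d‖u‖` and the coefficient is eventually small, the `‖u‖` part can be absorbed
  -- on the left of `h7`.
  have h8 : C * (d + c) * η * ‖f‖ ≤ ‖g‖ + c / 4 * ‖(u : K n)‖ := by
    have hκ0 : 0 ≤ C * (d + c) * η := by positivity
    have b1 := mul_le_mul_of_nonneg_left h6 hκ0
    have b2 := mul_le_mul_of_nonneg_right hn1.le (norm_nonneg g)
    have b3 := mul_le_mul_of_nonneg_right hn2.le (norm_nonneg (u : K n))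
    linarith
  rw [div_mul_eq_mul_div, div_le_iff₀ (by positivity)]
  linarith

theorem NormResolventConv.exists_nhds_subset_resolventSet {J : ∀ n, H →L[ℂ] K n}
    {An : ∀ n, K n →ₗ.[ℂ] K n} {A : H →ₗ.[ℂ] H} (hAn : ∀ n, IsSelfAdjoint (An n))
    (h : NormResolventConv J An A) {l : ℂ} (hl : l ∈ resolventSet A) :
    ∃ U ∈ 𝓝 l, ∀ᶠ n in atTop, U ⊆ resolventSet (An n) := by
  obtain ⟨c, hc, hev⟩ := h.exists_eventually_le hAn hl
  exact ⟨Metric.ball l c, Metric.ball_mem_nhds l hc,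
    hev.mono fun n hn => ball_subset_resolventSet (hAn n) hn⟩

end Convergence

end GenRes

theorem mainTheorem2
    {H : Type*} [NormedAddCommGroup H] [InnerProductSpace ℂ H] [CompleteSpace H]
    [TopologicalSpace.SeparableSpace H]
    {K : ℕ → Type*} [∀ n, NormedAddCommGroup (K n)] [∀ n, InnerProductSpace ℂ (K n)]
    [∀ n, CompleteSpace (K n)] [∀ n, TopologicalSpace.SeparableSpace (K n)]
    [∀ n, Nontrivial (K n)]
    (J : ∀ n, H →L[ℂ] K n) (An : ∀ n, K n →ₗ.[ℂ] K n) (A : H →ₗ.[ℂ] H)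
    (hAn : ∀ n, IsSelfAdjoint (An n)) (hA : IsSelfAdjoint A) :
    (GenRes.StrongResolventConv J An A →
      GenRes.spectrum A ⊆ GenRes.limSet (fun n => GenRes.spectrum (An n))) ∧
    (GenRes.NormResolventConv J An A →
      GenRes.spectrum A = GenRes.limSet (fun n => GenRes.spectrum (An n)) ∧
      ∀ l ∈ GenRes.resolventSet A, ∃ U ∈ 𝓝 l,
        ∀ᶠ n in atTop, U ⊆ GenRes.resolventSet (An n)) := by
  refine ⟨GenRes.spectrum_subset_limSet_of_strongResolventConv hAn hA, fun h => ?_⟩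
  have hU := fun l hl => h.exists_nhds_subset_resolventSet hAn (l := l) hl
  refine ⟨Set.Subset.antisymm (GenRes.spectrum_subset_limSet_of_strongResolventConv hAn hA
    (h.strongResolventConv hAn)) ?_, hU⟩
  rintro l ⟨s, hs, hsl⟩ hl
  obtain ⟨U, hUl, hUn⟩ := hU l hl
  obtain ⟨n, hn, hsn⟩ := (hUn.and (hsl.eventually hUl)).exists
  exact hs n (hn hsn)
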